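/- Let $n\ge 0$ be an integer and let $\varphi\in C_c^\infty(\mathbb R^n)$ be nonnegative with $\varphi(\xi)=1$ for $|\xi|\le 1/2$ and $\varphi(\xi)=0$ for $|\xi|\ge 1$. Put $\psi(\xi)=\varphi(\xi/2)-\varphi(\xi)$ and, for $f\in\mathcal S'(\mathbb R^n)$ and $j\in\mathbb Z$, let $\Delta_jf$ be the tempered distribution with $\widehat{\Delta_jf}(\xi)=\psi(2^{-j}\xi)\hat f(\xi)$. For $s\in\mathbb R$ and $1\le q,\rho\le\infty$ let $$\|f\|_{\dot B^{s,q}_{\rho}}=\Big(\sum_{j\in\mathbb Z}2^{js\rho}\|\Delta_jf\|_{L^q}^{\rho}\Big)^{1/\rho}$$ (supremum over $j$ if $\rho=\infty$), where $\|\Delta_j f\|_{L^q}=\infty$ if $\Delta_jf$ is not an $L^q$ function. For a measurable function $F$ on $\mathbb R^n$ let $F^*(s)=\inf\{t\ge 0:|\{x:|F(x)|\ge t\}|\le s\}$ and $$\|F\|_{L^{p,r}}=\Big(\int_0^\infty\big(s^{1/p}F^*(s)\big)^r\frac{ds}{s}\Big)^{1/r}$$ ($\sup_{s>0}s^{1/p}F^*(s)$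 if $r=\infty$). **Theorem.** Let $\alpha,\beta>0$, $\theta=\frac{\alpha}{\alpha+\beta}\in(0,1)$, $q_0,q_1\in[1,\infty]$ with $q_0<q_1$, and $q_0\le r_0\le r_1\le q_1$. Define $p$ and $r$ by $$\frac1p=\frac{1-\theta}{q_0}+\frac{\theta}{q_1},\qquad \frac1r=\frac{1-\theta}{r_0}+\frac{\theta}{r_1}.$$ Then there is a constant $C<\infty$, depending only on $n,\varphi,\alpha,\beta,q_0,q_1,r_0,r_1$, such that every $f\in\mathcal S'(\mathbb R^n)$ for which $f=\sum_{j\in\mathbb Z}\Delta_jf$ in $\mathcal S'(\mathbb R^n)$ and both $\|f\|_{\dot B^{\alpha,q_0}_{r_0}}$ and $\|f\|_{\dot B^{-\beta,q_1}_{r_1}}$ are finite is given by a function in $L^{p,r}(\mathbb R^n)$, and $$\|f\|_{L^{p,r}}\le C\,\|f\|_{\dot B^{\alpha,q_0}_{r_0}}^{1-\theta}\,\|f\|_{\dot B^{-\beta,q_1}_{r_1}}^{\theta}.$$ -/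

import Mathlib

open MeasureTheory Filter Topology
open scoped ENNReal NNReal ContDiff SchwartzMap

noncomputable section

namespace LorentzBesov

/-! ### Littlewood-Paley blocks -/

/-- A Littlewood-Paley cut-off on `ℝⁿ`: a nonnegative smooth function equal to `1` on
`|ξ| ≤ 1/2` and to `0` on `|ξ| ≥ 1`. -/
structure IsCutoff {n : ℕ} (φ : EuclideanSpace ℝ (Fin n) → ℝ) : Prop where
  contDiff : ContDiff ℝ ∞ φ
  nonneg : ∀ ξ, 0 ≤ φ ξ
  eq_one : ∀ ξ, ‖ξ‖ ≤ 1 / 2 → φ ξ = 1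
  eq_zero : ∀ ξ, 1 ≤ ‖ξ‖ → φ ξ = 0

/-- `ψ(ξ) = φ(ξ/2) - φ(ξ)`. -/
def annulus {n : ℕ} (φ : EuclideanSpace ℝ (Fin n) → ℝ) (ξ : EuclideanSpace ℝ (Fin n)) : ℝ :=
  φ ((2 : ℝ)⁻¹ • ξ) - φ ξ

/-- The dyadic block `Δ_j f`, i.e. the tempered distribution with Fourier transform
`ψ(2^{-j} ξ) f̂(ξ)`. -/
def dyadicBlock {n : ℕ} (φ : EuclideanSpace ℝ (Fin n) → ℝ) (j : ℤ)
    (f : 𝓢'(EuclideanSpace ℝ (Fin n), ℂ)) : 𝓢'(EuclideanSpace ℝ (Fin n), ℂ) :=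
  TemperedDistribution.fourierMultiplierCLM ℂ
    (fun ξ ↦ ((annulus φ ((2 : ℝ) ^ (-j) • ξ) : ℝ) : ℂ)) f

/-- `f = ∑_{j ∈ ℤ} Δ_j f` in `𝓢'`: the partial sums over `-M ≤ j < N` converge to `f` when `M`
and `N` tend to infinity. -/
def HasDyadicDecomposition {n : ℕ} (φ : EuclideanSpace ℝ (Fin n) → ℝ)
    (f : 𝓢'(EuclideanSpace ℝ (Fin n), ℂ)) : Prop :=
  Tendsto (fun N : ℕ × ℕ ↦ ∑ j ∈ Finset.Ico (-(N.1 : ℤ)) (N.2 : ℤ), dyadicBlock φ j f)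
    atTop (𝓝 f)

/-! ### Homogeneous Besov norms -/

/-- The tempered distribution `u` is (integration against) the function `g`. -/
def Represents {n : ℕ} (g : EuclideanSpace ℝ (Fin n) → ℂ)
    (u : 𝓢'(EuclideanSpace ℝ (Fin n), ℂ)) : Prop :=
  AEStronglyMeasurable g volume ∧
    ∀ h : 𝓢(EuclideanSpace ℝ (Fin n), ℂ),
      Integrable (fun x ↦ h x * g x) volume ∧ u h = ∫ x, h x * g x

/-- The `L^p` norm of a tempered distribution: the `L^p` norm of the (almost everywhere unique)
function representing it, and `∞` if there is none. -/
def distLpNorm {n : ℕ} (p : ℝ≥0∞) (u : 𝓢'(EuclideanSpace ℝ (Fin n), ℂ)) : ℝ≥0∞ :=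
  ⨅ (g : EuclideanSpace ℝ (Fin n) → ℂ) (_ : Represents g u), eLpNorm g p volume

/-- The homogeneous Besov (semi-)norm with regularity `s`, integrability `p` and summability `q`:
the `ℓ^q(ℤ)` norm of the sequence `2^{js} ‖Δ_j f‖_{L^p}`. -/
def besovNorm {n : ℕ} (φ : EuclideanSpace ℝ (Fin n) → ℝ) (s : ℝ) (p q : ℝ≥0∞)
    (f : 𝓢'(EuclideanSpace ℝ (Fin n), ℂ)) : ℝ≥0∞ :=
  if q = ⊤ then
    ⨆ j : ℤ, (2 : ℝ≥0∞) ^ ((j : ℝ) * s) * distLpNorm p (dyadicBlock φ j f)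
  else
    (∑' j : ℤ, ((2 : ℝ≥0∞) ^ ((j : ℝ) * s) * distLpNorm p (dyadicBlock φ j f)) ^ q.toReal)
      ^ (1 / q.toReal)

/-! ### Lorentz norms -/

/-- The decreasing rearrangement `f^*(s) = inf {t : μ {|f| ≥ t} ≤ s}`. -/
def rearrangement {X : Type*} [MeasurableSpace X] (μ : Measure X) (f : X → ℂ)
    (s : ℝ≥0∞) : ℝ≥0∞ :=
  sInf {t : ℝ≥0∞ | μ {x | t ≤ ‖f x‖ₑ} ≤ s}

/-- The Lorentz (quasi-)norm of `L^{p,r}(X, μ)`: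
`(∫_0^∞ (s^{1/p} f^*(s))^r ds/s)^{1/r}`, and `sup_{s>0} s^{1/p} f^*(s)` for `r = ∞`. -/
def lorentzNorm {X : Type*} [MeasurableSpace X] (μ : Measure X) (p r : ℝ≥0∞)
    (f : X → ℂ) : ℝ≥0∞ :=
  if r = ⊤ then
    ⨆ (s : ℝ) (_ : 0 < s),
      ENNReal.ofReal s ^ (1 / p.toReal) * rearrangement μ f (ENNReal.ofReal s)
  else
    (∫⁻ s in Set.Ioi (0 : ℝ),
      (ENNReal.ofReal s ^ (1 / p.toReal) * rearrangement μ f (ENNReal.ofReal s)) ^ r.toReal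
        / ENNReal.ofReal s) ^ (1 / r.toReal)

end LorentzBesov

end

/-!
The inequality is a real interpolation statement in which the only role of the Littlewood-Paley
blocks is to be the terms of a series converging to `f`. Let `g_j` be the function representing
`Δ_j f`, and put `A_N = ∑_{j ≥ N} ‖g_j‖_{q₀}` and `B_N = ∑_{j < N} ‖g_j‖_{q₁}`. Since `α, β > 0`,
Minkowski's inequality in `ℓ^{r₀}` and `ℓ^{r₁}` (`eLpNorm_tailSum_le`) shows that `2^{Nα} A_N` and
`2^{-Nβ} B_N` are controlled by the two Besov norms.

Splitting the series at `N` and applying Chebyshev's inequality to each part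
(`rearrangement_add_self_le`) gives, with `δ = 1/q₀ - 1/q₁`,
`s^{1/p} F^*(s) ≤ 2 (s^{-θδ} A_N + s^{(1-θ)δ} B_N)` for every `N`. The best `N` depends on `s`; at the
last `N` for which the first term dominates, the left side is at most
`4 min (s^{-θδ} A_N) (s^{(1-θ)δ} B_{N+1})` (`exists_le_two_mul_min`). As a function of `s` this is a
bump with power decay on both sides of its maximum `A_N^{1-θ} B_{N+1}^θ`, so it can be replaced by
the sum over all `N`, and the `L^r(ds/s)` norm is at most a constant times the `ℓ^r` norm of
`A_N^{1-θ} B_{N+1}^θ` (`exists_eLpNorm_bound_of_le_min`). In this product the weights `2^{Nα}` and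
`2^{-Nβ}` cancel, because `α (1 - θ) = β θ`, and Hölder's inequality with
`1/r = (1-θ)/r₀ + θ/r₁` concludes (`eLpNorm_rpow_mul_rpow_le`, `exists_lorentzNorm_le`). Different
exponents `r₀` and `r₁` need no extra argument, since `N` is chosen from `A` and `B` themselves.

The finiteness of `A_0` and `B_0` makes `∑ g_j` converge absolutely in `L^{q₀} + L^{q₁}`, hence it
represents `f` (`Represents.tsum`).

Throughout, `ℓ^r` norms are `L^r` norms for the counting measure on `ℤ`, which makes
Minkowski's inequality for countable sums (`eLpNorm_tsum_le`) available both for functions and for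
sequences.
-/

namespace LorentzBesov

/-! ### Countable sums, `ℓ^r` norms and Hölder's inequality -/

/-- Minkowski's inequality for countable sums of nonnegative functions. -/
theorem eLpNorm_tsum_le {X ι : Type*} [MeasurableSpace X] [Countable ι] {μ : Measure X}
    {u : ι → X → ℝ≥0∞} (hu : ∀ i, AEMeasurable (u i) μ) {q : ℝ≥0∞} (hq : 1 ≤ q) :
    eLpNorm (fun x ↦ ∑' i, u i x) q μ ≤ ∑' i, eLpNorm (u i) q μ := by
  rcases eq_or_ne q ⊤ with rfl | hq'
  · simp only [eLpNorm_exponent_top, eLpNormEssSup, enorm_eq_self]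
    refine essSup_le_of_ae_le _ ?_
    have : ∀ᵐ x ∂μ, ∀ i, u i x ≤ essSup (u i) μ := ae_all_iff.2 fun i ↦ ENNReal.ae_le_essSup _
    filter_upwards [this] with x hx
    exact ENNReal.tsum_le_tsum hx
  have hq0 : q ≠ 0 := (zero_lt_one.trans_le hq).ne'
  have hqr : 0 < q.toReal := ENNReal.toReal_pos hq0 hq'
  rw [eLpNorm_eq_lintegral_rpow_enorm_toReal hq0 hq', one_div,
    ENNReal.rpow_inv_le_iff hqr]
  have hsup : ∀ x, ‖∑' i, u i x‖ₑ ^ q.toReal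
      = ⨆ s : Finset ι, (∑ i ∈ s, u i x) ^ q.toReal := by
    intro x
    rw [enorm_eq_self, ENNReal.tsum_eq_iSup_sum]
    exact (ENNReal.orderIsoRpow q.toReal hqr).map_iSup _
  simp_rw [hsup]
  rw [lintegral_iSup_directed]
  · refine iSup_le fun s ↦ ?_
    have h1 := eLpNorm_sum_le (s := s) (fun i _ ↦ (hu i).aestronglyMeasurable) hq
    have h2 := h1.trans (ENNReal.sum_le_tsum s)
    rw [eLpNorm_eq_lintegral_rpow_enorm_toReal hq0 hq', one_div,
      ENNReal.rpow_inv_le_iff hqr] at h2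
    simpa using h2
  · intro s
    exact (Finset.aemeasurable_fun_sum s fun i _ ↦ hu i).pow_const _
  · refine Monotone.directed_le fun s t hst x ↦ ?_
    exact ENNReal.rpow_le_rpow (Finset.sum_le_sum_of_subset hst) hqr.le

/-- The `ℓ^r` norm as an `L^r` norm for the counting measure, in the form in which Besov norms are
written. -/
theorem eLpNorm_count {ι : Type*} [MeasurableSpace ι] [MeasurableSingletonClass ι]
    (a : ι → ℝ≥0∞) {r : ℝ≥0∞} (hr : r ≠ 0) :
    eLpNorm a r Measure.count =
      if r = ⊤ then ⨆ i, a i else (∑' i, a i ^ r.toReal) ^ (1 / r.toReal) := by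
  split_ifs with h
  · subst h
    simp only [eLpNorm_exponent_top, eLpNormEssSup, enorm_eq_self]
    refine le_antisymm (essSup_le_of_ae_le _ (ae_of_all _ fun i ↦ le_iSup a i))
      (iSup_le fun i ↦ ?_)
    by_contra hi
    have h0 : Measure.count {j | ¬ a j ≤ essSup a Measure.count} = 0 :=
      ENNReal.ae_le_essSup a
    rw [Measure.count_eq_zero_iff] at h0
    exact h0.subset hi
  · rw [eLpNorm_eq_lintegral_rpow_enorm_toReal hr h, lintegral_count]
    simp

theorem le_eLpNorm_count {ι : Type*} [MeasurableSpace ι] [MeasurableSingletonClass ι]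
    (a : ι → ℝ≥0∞) {r : ℝ≥0∞} (hr : r ≠ 0) (i : ι) : a i ≤ eLpNorm a r Measure.count := by
  rw [eLpNorm_count a hr]
  split_ifs with h
  · exact le_iSup a i
  · have hp := ENNReal.toReal_pos hr h
    rw [one_div, ENNReal.le_rpow_inv_iff hp]
    exact ENNReal.le_tsum (f := fun i ↦ a i ^ r.toReal) i

theorem eLpNorm_count_comp_equiv {ι : Type*} [MeasurableSpace ι] [MeasurableSingletonClass ι]
    (a : ι → ℝ≥0∞) {r : ℝ≥0∞} (hr : r ≠ 0) (e : ι ≃ ι) :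
    eLpNorm (fun i ↦ a (e i)) r Measure.count = eLpNorm a r Measure.count := by
  rw [eLpNorm_count _ hr, eLpNorm_count _ hr]
  split_ifs with h
  · exact e.iSup_comp
  · rw [e.tsum_eq fun i ↦ a i ^ r.toReal]

theorem eLpNorm_const_mul_ennreal {X : Type*} [MeasurableSpace X] {μ : Measure X}
    (c : ℝ≥0∞) (hc : c ≠ ⊤) (a : X → ℝ≥0∞) (q : ℝ≥0∞) :
    eLpNorm (fun x ↦ c * a x) q μ ≤ c * eLpNorm a q μ := by
  lift c to ℝ≥0 using hc
  exact eLpNorm_le_nnreal_smul_eLpNorm_of_ae_le_mul' (ae_of_all _ fun x ↦ by simp) q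

theorem toReal_inv_of_inv_eq {θ : ℝ} (hθ0 : 0 ≤ θ) (hθ1 : θ ≤ 1) {p q₀ q₁ : ℝ≥0∞} (hq₀ : q₀ ≠ 0)
    (hq₁ : q₁ ≠ 0) (hp : p⁻¹ = ENNReal.ofReal (1 - θ) * q₀⁻¹ + ENNReal.ofReal θ * q₁⁻¹) :
    p.toReal⁻¹ = (1 - θ) * q₀.toReal⁻¹ + θ * q₁.toReal⁻¹ := by
  have := congrArg ENNReal.toReal hp
  rwa [ENNReal.toReal_add (by finiteness) (by finiteness), ENNReal.toReal_mul,
    ENNReal.toReal_mul, ENNReal.toReal_inv, ENNReal.toReal_inv, ENNReal.toReal_inv,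
    ENNReal.toReal_ofReal hθ0, ENNReal.toReal_ofReal (sub_nonneg.2 hθ1)] at this

theorem ne_zero_of_inv_eq {θ : ℝ} {p q₀ q₁ : ℝ≥0∞} (hq₀ : q₀ ≠ 0) (hq₁ : q₁ ≠ 0)
    (hp : p⁻¹ = ENNReal.ofReal (1 - θ) * q₀⁻¹ + ENNReal.ofReal θ * q₁⁻¹) : p ≠ 0 := by
  rintro rfl
  have := hp.symm
  simp [ENNReal.mul_eq_top, hq₀, hq₁] at this

/-- Hölder's inequality for a geometric mean. Infinite exponents are allowed, and `r₀ ≤ r₁` only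
serves to exclude the case `r₀ = ∞ > r₁`. -/
theorem eLpNorm_rpow_mul_rpow_le {X : Type*} [MeasurableSpace X] {μ : Measure X}
    {a b : X → ℝ≥0∞} (ha : AEMeasurable a μ) (hb : AEMeasurable b μ) {θ : ℝ} (hθ0 : 0 < θ)
    (hθ1 : θ < 1) {r r₀ r₁ : ℝ≥0∞} (hr₀ : r₀ ≠ 0) (hr₀₁ : r₀ ≤ r₁)
    (hr : r⁻¹ = ENNReal.ofReal (1 - θ) * r₀⁻¹ + ENNReal.ofReal θ * r₁⁻¹) :
    eLpNorm (fun x ↦ a x ^ (1 - θ) * b x ^ θ) r μ ≤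
      eLpNorm a r₀ μ ^ (1 - θ) * eLpNorm b r₁ μ ^ θ := by
  have h1θ : 0 < 1 - θ := by linarith
  have hr₁ : r₁ ≠ 0 := (pos_iff_ne_zero.2 hr₀ |>.trans_le hr₀₁).ne'
  rcases eq_or_ne r₀ ⊤ with h₀ | h₀
  · have h₁ : r₁ = ⊤ := top_le_iff.1 (h₀ ▸ hr₀₁)
    have h : r = ⊤ := by simpa [h₀, h₁] using hr
    subst h₀ h₁ h
    simp only [eLpNorm_exponent_top, eLpNormEssSup, enorm_eq_self]
    refine essSup_le_of_ae_le _ ?_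
    filter_upwards [ENNReal.ae_le_essSup a, ENNReal.ae_le_essSup b] with x hx hy
    gcongr
  have h₀' := ENNReal.toReal_pos hr₀ h₀
  have hrtop : r ≠ ⊤ := by
    rintro rfl
    have := hr.symm
    simp [h₀] at this
    linarith
  have hr0 : r ≠ 0 := ne_zero_of_inv_eq hr₀ hr₁ hr
  have hr' := ENNReal.toReal_pos hr0 hrtop
  have hreal := toReal_inv_of_inv_eq hθ0.le hθ1.le hr₀ hr₁ hr
  rw [eLpNorm_eq_lintegral_rpow_enorm_toReal hr0 hrtop,
    eLpNorm_eq_lintegral_rpow_enorm_toReal hr₀ h₀, one_div, ENNReal.rpow_inv_le_iff hr']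
  simp only [enorm_eq_self]
  rcases eq_or_ne r₁ ⊤ with h₁ | h₁
  · subst h₁
    have e : (1 - θ) * r.toReal = r₀.toReal := by
      simp only [ENNReal.toReal_top, inv_zero, mul_zero, add_zero] at hreal
      field_simp at hreal
      linarith
    simp only [eLpNorm_exponent_top, eLpNormEssSup, enorm_eq_self]
    calc ∫⁻ x, (a x ^ (1 - θ) * b x ^ θ) ^ r.toReal ∂μ
        ≤ ∫⁻ x, a x ^ r₀.toReal * ((essSup b μ) ^ θ) ^ r.toReal ∂μ := by
          refine lintegral_mono_ae ?_
          filter_upwards [ENNReal.ae_le_essSup b] with x hx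
          rw [ENNReal.mul_rpow_of_nonneg _ _ hr'.le, ← ENNReal.rpow_mul (a x), e]
          gcongr
      _ = (∫⁻ x, a x ^ r₀.toReal ∂μ) * ((essSup b μ) ^ θ) ^ r.toReal :=
          lintegral_mul_const'' _ (ha.pow_const _)
      _ = _ := by
          rw [ENNReal.mul_rpow_of_nonneg _ _ hr'.le, ← ENNReal.rpow_mul, ← ENNReal.rpow_mul,
            e, ← ENNReal.rpow_mul, one_div_mul_cancel h₀'.ne', ENNReal.rpow_one]
  · have h₁' := ENNReal.toReal_pos hr₁ h₁
    rw [eLpNorm_eq_lintegral_rpow_enorm_toReal hr₁ h₁]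
    simp only [enorm_eq_self]
    have hsum : (1 - θ) * r.toReal / r₀.toReal + θ * r.toReal / r₁.toReal = 1 := by
      field_simp at hreal ⊢
      linarith
    have key := ENNReal.lintegral_mul_norm_pow_le (μ := μ) (ha.pow_const r₀.toReal)
      (hb.pow_const r₁.toReal) (p := (1 - θ) * r.toReal / r₀.toReal)
      (q := θ * r.toReal / r₁.toReal) (by positivity) (by positivity) hsum
    calc ∫⁻ x, (a x ^ (1 - θ) * b x ^ θ) ^ r.toReal ∂μ
        = ∫⁻ x, (a x ^ r₀.toReal) ^ ((1 - θ) * r.toReal / r₀.toReal) *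
            (b x ^ r₁.toReal) ^ (θ * r.toReal / r₁.toReal) ∂μ := by
          refine lintegral_congr fun x ↦ ?_
          rw [ENNReal.mul_rpow_of_nonneg _ _ hr'.le]
          simp only [← ENNReal.rpow_mul]
          congr 2 <;> field_simp
      _ ≤ _ := key
      _ = _ := by
          rw [ENNReal.mul_rpow_of_nonneg _ _ hr'.le]
          simp only [← ENNReal.rpow_mul]
          congr 2 <;> field_simp

/-! ### Rearrangements and power integrals -/

/-- Chebyshev's inequality, uniformly in `q ∈ (0, ∞]`: for `q = ∞` the exponent `1 / q.toReal` is
`0`, so that the hypothesis reads `‖U‖_∞ < c`. -/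
theorem meas_ge_le_of_rpow_mul_eLpNorm_lt {X : Type*} [MeasurableSpace X] {μ : Measure X}
    {U : X → ℝ≥0∞} (hU : AEMeasurable U μ) {q s c : ℝ≥0∞} (hq : q ≠ 0) (hs0 : s ≠ 0)
    (hs : s ≠ ⊤) (hc : c ≠ ⊤) (h : s ^ (-(1 / q.toReal)) * eLpNorm U q μ < c) :
    μ {x | c ≤ U x} ≤ s := by
  rcases eq_or_ne q ⊤ with rfl | hq'
  · have h' : essSup U μ < c := by simpa [eLpNormEssSup] using h
    have h0 : μ {x | c ≤ U x} = 0 := by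
      refine measure_mono_null (fun x hx ↦ ?_) (meas_essSup_lt (f := U) (μ := μ))
      exact h'.trans_le hx
    simp [h0]
  have hqr := ENNReal.toReal_pos hq hq'
  have hc0 : c ≠ 0 := (pos_of_gt h).ne'
  have h1 := mul_meas_ge_le_pow_eLpNorm' μ hq hq' hU.aestronglyMeasurable c
  simp only [enorm_eq_self] at h1
  have h2 : eLpNorm U q μ ≤ s ^ (1 / q.toReal) * c := by
    calc eLpNorm U q μ
        = s ^ (1 / q.toReal) * (s ^ (-(1 / q.toReal)) * eLpNorm U q μ) := by
          rw [← mul_assoc, ← ENNReal.rpow_add _ _ hs0 hs]; simp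
      _ ≤ _ := by gcongr
  have h3 : c ^ q.toReal * μ {x | c ≤ U x} ≤ c ^ q.toReal * s := by
    refine h1.trans ((ENNReal.rpow_le_rpow h2 hqr.le).trans_eq ?_)
    rw [ENNReal.mul_rpow_of_nonneg _ _ hqr.le, ← ENNReal.rpow_mul,
      one_div_mul_cancel hqr.ne', ENNReal.rpow_one, mul_comm]
  rwa [ENNReal.mul_le_mul_iff_right (by simp [hc0, hc]) (by finiteness)] at h3

/-- The rearrangement at `2s` of a function dominated by `U + V` is controlled by the weak-type
bounds of `U` and `V` at `s`. -/
theorem rearrangement_add_self_le {X : Type*} [MeasurableSpace X] {μ : Measure X} {F : X → ℂ}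
    {U V : X → ℝ≥0∞} (hU : AEMeasurable U μ) (hV : AEMeasurable V μ)
    (hF : ∀ᵐ x ∂μ, ‖F x‖ₑ ≤ U x + V x) {q₀ q₁ s : ℝ≥0∞} (hq₀ : q₀ ≠ 0) (hq₁ : q₁ ≠ 0)
    (hs0 : s ≠ 0) (hs : s ≠ ⊤) :
    rearrangement μ F (s + s) ≤
      s ^ (-(1 / q₀.toReal)) * eLpNorm U q₀ μ + s ^ (-(1 / q₁.toReal)) * eLpNorm V q₁ μ := by
  refine ENNReal.le_of_forall_pos_le_add fun ε hε hfin ↦ ?_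
  set a := s ^ (-(1 / q₀.toReal)) * eLpNorm U q₀ μ
  set b := s ^ (-(1 / q₁.toReal)) * eLpNorm V q₁ μ
  have ha : a ≠ ⊤ := (le_self_add.trans_lt hfin).ne
  have hb : b ≠ ⊤ := (le_add_self.trans_lt hfin).ne
  have hε2 : (ε / 2 : ℝ≥0∞) ≠ 0 := by simp [hε.ne']
  have hε2' : (ε / 2 : ℝ≥0∞) ≠ ⊤ := by finiteness
  -- The levels are raised by `ε / 2` because Chebyshev's inequality says nothing at level `0`.
  refine sInf_le ?_
  have hsub : μ {x | a + b + ε ≤ ‖F x‖ₑ} ≤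
      μ ({x | a + ε / 2 ≤ U x} ∪ {x | b + ε / 2 ≤ V x}) := by
    refine measure_mono_ae ?_
    filter_upwards [hF] with x hx hx'
    by_contra! hcon
    have hcon' : ¬ (a + ε / 2 ≤ U x ∨ b + ε / 2 ≤ V x) := hcon
    push Not at hcon'
    have := ENNReal.add_lt_add hcon'.1 hcon'.2
    rw [add_add_add_comm, ENNReal.add_halves] at this
    exact absurd ((le_trans (show a + b + ε ≤ ‖F x‖ₑ from hx') hx)) (not_le.2 this)
  refine hsub.trans ((measure_union_le _ _).trans (add_le_add ?_ ?_))
  · exact meas_ge_le_of_rpow_mul_eLpNorm_lt hU hq₀ hs0 hs (by finiteness)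
      (ENNReal.lt_add_right ha hε2)
  · exact meas_ge_le_of_rpow_mul_eLpNorm_lt hV hq₁ hs0 hs (by finiteness)
      (ENNReal.lt_add_right hb hε2)

theorem half_rpow_neg_le {s q : ℝ≥0∞} (hq : 1 ≤ q) :
    (s / 2) ^ (-(1 / q.toReal)) ≤ 2 * s ^ (-(1 / q.toReal)) := by
  have h1 : 1 / q.toReal ≤ 1 := by
    rcases eq_or_ne q ⊤ with rfl | hq'
    · simp
    · rw [one_div]
      exact inv_le_one_of_one_le₀ (by simpa using ENNReal.toReal_mono hq' hq)
  have h0 : 0 ≤ 1 / q.toReal := by positivity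
  rw [ENNReal.rpow_neg, ENNReal.rpow_neg, ENNReal.div_rpow_of_nonneg _ _ h0,
    ENNReal.inv_div (by simp) (by simp), div_eq_mul_inv]
  gcongr
  calc (2 : ℝ≥0∞) ^ (1 / q.toReal) ≤ 2 ^ (1 : ℝ) :=
        ENNReal.rpow_le_rpow_of_exponent_le (by norm_num) h1
    _ = 2 := by simp

/-- The `L^r(ds/s)` norm of the bump `min (s^{-θδ} A) (s^{(1-θ)δ} B)` is at most a constant times
its maximum `A^{1-θ} B^θ`, which is attained where `s^δ = A / B`: the bump decays like a power of `s` on both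
sides of that point. -/
theorem exists_lintegral_min_rpow_le {θ δ r : ℝ} (hθ0 : 0 < θ) (hθ1 : θ < 1) (hδ : 0 < δ)
    (hr : 0 < r) :
    ∃ C : ℝ≥0, ∀ A B : ℝ≥0∞, A ≠ ⊤ → B ≠ ⊤ →
      ∫⁻ s in Set.Ioi (0 : ℝ),
        (min (ENNReal.ofReal s ^ (-(θ * δ)) * A) (ENNReal.ofReal s ^ ((1 - θ) * δ) * B)) ^ r
          / ENNReal.ofReal s ≤ C * (A ^ (1 - θ) * B ^ θ) ^ r := by
  have h1θ : 0 < 1 - θ := by linarith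
  refine ⟨(1 / ((1 - θ) * δ * r) + 1 / (θ * δ * r)).toNNReal, fun A B hA hB ↦ ?_⟩
  rcases eq_or_ne A 0 with rfl | hA0
  · simp [hr]
  rcases eq_or_ne B 0 with rfl | hB0
  · simp [hr]
  have ha : 0 < A.toReal := ENNReal.toReal_pos hA0 hA
  have hb : 0 < B.toReal := ENNReal.toReal_pos hB0 hB
  rw [← ENNReal.ofReal_toReal hA, ← ENNReal.ofReal_toReal hB]
  generalize A.toReal = a at *
  generalize B.toReal = b at *
  clear hA hB hA0 hB0 A B
  have hu : 0 < θ * δ * r := by positivity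
  have hv : 0 < (1 - θ) * δ * r := by positivity
  set s₀ : ℝ := (a / b) ^ (1 / δ) with hs₀
  have hs₀pos : 0 < s₀ := by positivity
  have small : ∫⁻ s in Set.Ioc 0 s₀,
      (min (ENNReal.ofReal s ^ (-(θ * δ)) * ENNReal.ofReal a)
        (ENNReal.ofReal s ^ ((1 - θ) * δ) * ENNReal.ofReal b)) ^ r / ENNReal.ofReal s ≤
      ENNReal.ofReal (b ^ r * (s₀ ^ ((1 - θ) * δ * r) / ((1 - θ) * δ * r))) := by
    have hint : IntegrableOn (fun s : ℝ ↦ b ^ r * s ^ ((1 - θ) * δ * r - 1)) (Set.Ioc 0 s₀) :=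
      (((intervalIntegral.intervalIntegrable_rpow' (by linarith)).1).const_mul _)
    have hval : ∫ s in Set.Ioc 0 s₀, b ^ r * s ^ ((1 - θ) * δ * r - 1) =
        b ^ r * (s₀ ^ ((1 - θ) * δ * r) / ((1 - θ) * δ * r)) := by
      rw [integral_const_mul, ← intervalIntegral.integral_of_le hs₀pos.le,
        integral_rpow (Or.inl (by linarith)), sub_add_cancel, Real.zero_rpow hv.ne', sub_zero]
    rw [← hval, ofReal_integral_eq_lintegral_ofReal hint]
    · refine setLIntegral_mono' measurableSet_Ioc fun s hs ↦ ?_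
      have hs0 : 0 < s := hs.1
      calc _ ≤ (ENNReal.ofReal s ^ ((1 - θ) * δ) * ENNReal.ofReal b) ^ r / ENNReal.ofReal s := by
            gcongr; exact min_le_right _ _
        _ = _ := by
            rw [ENNReal.ofReal_rpow_of_pos hs0, ← ENNReal.ofReal_mul (by positivity),
              ENNReal.ofReal_rpow_of_pos (by positivity), ← ENNReal.ofReal_div_of_pos hs0,
              Real.mul_rpow (by positivity) hb.le, ← Real.rpow_mul hs0.le,
              Real.rpow_sub_one hs0.ne']
            congr 1
            ring
    · filter_upwards [ae_restrict_mem measurableSet_Ioc] with s hs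
      have hs0 : 0 < s := hs.1
      simp only [Pi.zero_apply]
      positivity
  have large : ∫⁻ s in Set.Ioi s₀,
      (min (ENNReal.ofReal s ^ (-(θ * δ)) * ENNReal.ofReal a)
        (ENNReal.ofReal s ^ ((1 - θ) * δ) * ENNReal.ofReal b)) ^ r / ENNReal.ofReal s ≤
      ENNReal.ofReal (a ^ r * (s₀ ^ (-(θ * δ * r)) / (θ * δ * r))) := by
    have hlt : -(θ * δ * r) - 1 < -1 := by linarith
    have hint : IntegrableOn (fun s : ℝ ↦ a ^ r * s ^ (-(θ * δ * r) - 1)) (Set.Ioi s₀) :=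
      ((integrableOn_Ioi_rpow_of_lt hlt hs₀pos).const_mul _)
    have hval : ∫ s in Set.Ioi s₀, a ^ r * s ^ (-(θ * δ * r) - 1) =
        a ^ r * (s₀ ^ (-(θ * δ * r)) / (θ * δ * r)) := by
      rw [integral_const_mul, integral_Ioi_rpow_of_lt hlt hs₀pos, sub_add_cancel, neg_div_neg_eq]
    rw [← hval, ofReal_integral_eq_lintegral_ofReal hint]
    · refine setLIntegral_mono' measurableSet_Ioi fun s hs ↦ ?_
      have hs0 : 0 < s := hs₀pos.trans hs
      calc _ ≤ (ENNReal.ofReal s ^ (-(θ * δ)) * ENNReal.ofReal a) ^ r / ENNReal.ofReal s := by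
            gcongr; exact min_le_left _ _
        _ = _ := by
            rw [ENNReal.ofReal_rpow_of_pos hs0, ← ENNReal.ofReal_mul (by positivity),
              ENNReal.ofReal_rpow_of_pos (by positivity), ← ENNReal.ofReal_div_of_pos hs0,
              Real.mul_rpow (by positivity) ha.le, ← Real.rpow_mul hs0.le,
              Real.rpow_sub_one hs0.ne']
            congr 1
            ring_nf
    · filter_upwards [ae_restrict_mem measurableSet_Ioi] with s hs
      have hs0 : 0 < s := hs₀pos.trans hs
      simp only [Pi.zero_apply]
      positivity
  rw [← Set.Ioc_union_Ioi_eq_Ioi hs₀pos.le, lintegral_union measurableSet_Ioi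
    Set.Ioc_disjoint_Ioi_same]
  refine (add_le_add small large).trans_eq ?_
  have e1 : b ^ r * s₀ ^ ((1 - θ) * δ * r) = (a ^ (1 - θ) * b ^ θ) ^ r := by
    rw [hs₀, ← Real.rpow_mul (by positivity),
      show 1 / δ * ((1 - θ) * δ * r) = (1 - θ) * r by field_simp,
      Real.div_rpow ha.le hb.le, Real.mul_rpow (by positivity) (by positivity),
      ← Real.rpow_mul ha.le, ← Real.rpow_mul hb.le,
      show θ * r = r - (1 - θ) * r by ring, Real.rpow_sub hb]
    ring
  have e2 : a ^ r * s₀ ^ (-(θ * δ * r)) = (a ^ (1 - θ) * b ^ θ) ^ r := by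
    rw [hs₀, ← Real.rpow_mul (by positivity),
      show 1 / δ * (-(θ * δ * r)) = -(θ * r) by field_simp,
      Real.rpow_neg (by positivity),
      Real.div_rpow ha.le hb.le, Real.mul_rpow (by positivity) (by positivity),
      ← Real.rpow_mul ha.le, ← Real.rpow_mul hb.le,
      show (1 - θ) * r = r - θ * r by ring, Real.rpow_sub ha]
    field_simp
  rw [ENNReal.ofReal_rpow_of_pos ha, ENNReal.ofReal_rpow_of_pos hb,
    ← ENNReal.ofReal_mul (by positivity), ENNReal.ofReal_rpow_of_pos (by positivity),
    ← ENNReal.ofReal_add (by positivity) (by positivity), ← mul_div_assoc, ← mul_div_assoc,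
    e1, e2, ← ENNReal.ofReal.eq_1, ← ENNReal.ofReal_mul (by positivity)]
  congr 1
  ring

/-! ### Weighted tails of sequences -/

/-- The tail `∑_{j ≥ N} c_j` of a sequence indexed by `ℤ`. The head `∑_{j < N} c_j` is the tail
from `-N` on of the reflected sequence `m ↦ c_{-1-m}`. -/
noncomputable def tailSum (c : ℤ → ℝ≥0∞) (N : ℤ) : ℝ≥0∞ := ∑' i : ℕ, c (N + i)

theorem tailSum_antitone (c : ℤ → ℝ≥0∞) : Antitone (tailSum c) := by
  refine antitone_int_of_succ_le fun N ↦ ?_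
  have h := ENNReal.tsum_comp_le_tsum_of_injective (add_left_injective 1) fun i : ℕ ↦ c (N + i)
  refine le_trans (le_of_eq ?_) h
  exact tsum_congr fun i ↦ by push_cast; ring_nf

/-- A sum over `ℤ` is the tail from `N` on plus the head below `N`. -/
theorem tsum_eq_tailSum_add (c : ℤ → ℝ≥0∞) (N : ℤ) :
    ∑' j, c j = tailSum c N + tailSum (fun m ↦ c (-1 - m)) (-N) := by
  rw [← (Equiv.addLeft N).tsum_eq c,
    tsum_of_nat_of_neg_add_one ENNReal.summable ENNReal.summable]
  unfold tailSum
  congr 1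
  refine tsum_congr fun i ↦ ?_
  simp only [Equiv.coe_addLeft]
  ring_nf

theorem tsum_two_rpow_neg_ne_top {α : ℝ} (hα : 0 < α) :
    ∑' i : ℕ, (2 : ℝ≥0∞) ^ (-((i : ℝ) * α)) ≠ ⊤ := by
  have h : ∀ i : ℕ, (2 : ℝ≥0∞) ^ (-((i : ℝ) * α)) = ((2 : ℝ≥0∞) ^ (-α)) ^ i := fun i ↦ by
    rw [← ENNReal.rpow_natCast, ← ENNReal.rpow_mul]
    ring_nf
  simp_rw [h, ENNReal.tsum_geometric]
  have : (2 : ℝ≥0∞) ^ (-α) < 1 := ENNReal.rpow_lt_one_of_one_lt_of_neg (by norm_num) (by linarith)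
  simpa [tsub_eq_zero_iff_le] using this

/-- Discrete Hardy inequality: weighted tails are controlled by the weighted sequence. It is
Minkowski's inequality applied to `2^{Nα} ∑_{j ≥ N} c_j = ∑_{i ≥ 0} 2^{-iα} (2^{(N+i)α} c_{N+i})`. -/
theorem eLpNorm_tailSum_le (c : ℤ → ℝ≥0∞) (α : ℝ) {r : ℝ≥0∞} (hr : 1 ≤ r) :
    eLpNorm (fun N : ℤ ↦ (2 : ℝ≥0∞) ^ ((N : ℝ) * α) * tailSum c N) r Measure.count ≤
      (∑' i : ℕ, (2 : ℝ≥0∞) ^ (-((i : ℝ) * α))) *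
        eLpNorm (fun j : ℤ ↦ (2 : ℝ≥0∞) ^ ((j : ℝ) * α) * c j) r Measure.count := by
  have hr0 : r ≠ 0 := (zero_lt_one.trans_le hr).ne'
  have e : (fun N : ℤ ↦ (2 : ℝ≥0∞) ^ ((N : ℝ) * α) * tailSum c N) = fun N : ℤ ↦
      ∑' i : ℕ, (2 : ℝ≥0∞) ^ (-((i : ℝ) * α)) *
        ((2 : ℝ≥0∞) ^ (((N + i : ℤ) : ℝ) * α) * c (N + i)) := by
    funext N
    rw [tailSum, ← ENNReal.tsum_mul_left]
    refine tsum_congr fun i ↦ ?_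
    rw [← mul_assoc, ← ENNReal.rpow_add _ _ (by norm_num) (by norm_num)]
    push_cast
    ring_nf
  rw [e, ← ENNReal.tsum_mul_right]
  refine (eLpNorm_tsum_le (fun i ↦ (Measurable.of_discrete).aemeasurable) hr).trans ?_
  refine ENNReal.tsum_le_tsum fun i ↦ ?_
  refine (eLpNorm_const_mul_ennreal _ (by finiteness) _ _).trans_eq ?_
  congr 1
  exact eLpNorm_count_comp_equiv (fun j : ℤ ↦ (2 : ℝ≥0∞) ^ ((j : ℝ) * α) * c j) hr0
    (Equiv.addRight (i : ℤ))

theorem tailSum_le {c : ℤ → ℝ≥0∞} {α : ℝ} {r : ℝ≥0∞} (hr : 1 ≤ r) (N : ℤ) :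
    tailSum c N ≤ 2 ^ (-((N : ℝ) * α)) * ((∑' i : ℕ, (2 : ℝ≥0∞) ^ (-((i : ℝ) * α))) *
        eLpNorm (fun j : ℤ ↦ (2 : ℝ≥0∞) ^ ((j : ℝ) * α) * c j) r Measure.count) := by
  have hr0 : r ≠ 0 := (zero_lt_one.trans_le hr).ne'
  have h := (le_eLpNorm_count (fun N : ℤ ↦ (2 : ℝ≥0∞) ^ ((N : ℝ) * α) * tailSum c N)
    hr0 N).trans (eLpNorm_tailSum_le c α hr)
  calc tailSum c N = 2 ^ (-((N : ℝ) * α)) * (2 ^ ((N : ℝ) * α) * tailSum c N) := by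
        rw [← mul_assoc, ← ENNReal.rpow_add _ _ (by norm_num) (by norm_num)]
        simp
    _ ≤ _ := by gcongr

theorem tailSum_ne_top {c : ℤ → ℝ≥0∞} {α : ℝ} (hα : 0 < α) {r : ℝ≥0∞} (hr : 1 ≤ r)
    (hc : eLpNorm (fun j : ℤ ↦ (2 : ℝ≥0∞) ^ ((j : ℝ) * α) * c j) r Measure.count ≠ ⊤) (N : ℤ) :
    tailSum c N ≠ ⊤ :=
  ne_top_of_le_ne_top (ENNReal.mul_ne_top (by finiteness)
    (ENNReal.mul_ne_top (tsum_two_rpow_neg_ne_top hα) hc)) (tailSum_le hr N)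

theorem tendsto_tailSum {c : ℤ → ℝ≥0∞} {α : ℝ} (hα : 0 < α) {r : ℝ≥0∞} (hr : 1 ≤ r)
    (hc : eLpNorm (fun j : ℤ ↦ (2 : ℝ≥0∞) ^ ((j : ℝ) * α) * c j) r Measure.count ≠ ⊤) :
    Tendsto (tailSum c) atTop (𝓝 0) := by
  have hM := ENNReal.mul_ne_top (tsum_two_rpow_neg_ne_top hα) hc
  refine tendsto_of_tendsto_of_tendsto_of_le_of_le tendsto_const_nhds ?_ (fun _ ↦ zero_le)
    (fun N ↦ tailSum_le (α := α) hr N)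
  have h2 : Tendsto (fun N : ℤ ↦ (2 : ℝ≥0∞) ^ (-((N : ℝ) * α))) atTop (𝓝 0) := by
    have : Tendsto (fun N : ℤ ↦ -((N : ℝ) * α)) atTop atBot :=
      tendsto_neg_atTop_atBot.comp (tendsto_intCast_atTop_atTop.atTop_mul_const hα)
    exact (ENNReal.tendsto_rpow_atBot_of_one_lt_base (by norm_num)).comp this
  simpa using ENNReal.Tendsto.mul_const h2 (Or.inr hM)

/-- The reflected sequence in the weight `2^{mβ}` is controlled by the original one in the weight
`2^{-jβ}`; the offset `-1` in `j = -1 - m` costs the factor `2^{-β} ≤ 1`. -/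
theorem eLpNorm_reflect_le (c : ℤ → ℝ≥0∞) {β : ℝ} (hβ : 0 < β) {r : ℝ≥0∞} (hr : r ≠ 0) :
    eLpNorm (fun m : ℤ ↦ (2 : ℝ≥0∞) ^ ((m : ℝ) * β) * c (-1 - m)) r Measure.count ≤
      eLpNorm (fun j : ℤ ↦ (2 : ℝ≥0∞) ^ ((j : ℝ) * (-β)) * c j) r Measure.count := by
  rw [← eLpNorm_count_comp_equiv (fun j : ℤ ↦ (2 : ℝ≥0∞) ^ ((j : ℝ) * (-β)) * c j) hr
    (Equiv.subLeft (-1 : ℤ))]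
  refine eLpNorm_mono_enorm fun m ↦ ?_
  simp only [enorm_eq_self, Equiv.subLeft_apply]
  refine mul_le_mul_left (ENNReal.rpow_le_rpow_of_exponent_le (by norm_num) ?_) _
  push_cast
  nlinarith

/-! ### Interpolation for sums of functions -/

/-- The choice of the splitting index. If `K` is at most `x A_N + y B_N` for every `N`, with `A`
decreasing to `0` at `+∞` and `B` decreasing to `0` at `-∞`, then at the last `N` for which
`y B_N ≤ x A_N` the bounds for `N` and for `N + 1` give `K ≤ 2 x A_N` and `K ≤ 2 y B_{N+1}`. -/
theorem exists_le_two_mul_min {A B : ℤ → ℝ≥0∞} (hA : Antitone A) (hB : Monotone B)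
    (hA0 : Tendsto A atTop (𝓝 0)) (hB0 : Tendsto B atBot (𝓝 0)) {x y K : ℝ≥0∞}
    (hx0 : x ≠ 0) (hx : x ≠ ⊤) (hy0 : y ≠ 0) (hy : y ≠ ⊤)
    (hK : ∀ N, K ≤ x * A N + y * B N) :
    ∃ N, K ≤ 2 * min (x * A N) (y * B (N + 1)) := by
  have hxA : Tendsto (fun N ↦ x * A N) atTop (𝓝 0) := by
    simpa using ENNReal.Tendsto.const_mul hA0 (Or.inr hx)
  have hyB : Tendsto (fun N ↦ y * B N) atBot (𝓝 0) := by
    simpa using ENNReal.Tendsto.const_mul hB0 (Or.inr hy)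
  -- A greatest crossing index exists only if neither sequence vanishes identically; otherwise `K`
  -- is `0`, by letting `N` tend to the end where the other sequence vanishes.
  by_cases hAz : ∀ N, A N = 0
  · refine ⟨0, ?_⟩
    have : K ≤ 0 := ge_of_tendsto' hyB fun N ↦ by simpa [hAz] using hK N
    simp [le_zero_iff.1 this]
  by_cases hBz : ∀ N, B N = 0
  · refine ⟨0, ?_⟩
    have : K ≤ 0 := ge_of_tendsto' hxA fun N ↦ by simpa [hBz] using hK N
    simp [le_zero_iff.1 this]
  push Not at hAz hBz
  obtain ⟨n, hn⟩ := hAz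
  obtain ⟨m, hm⟩ := hBz
  have hn' : 0 < x * A n := pos_iff_ne_zero.2 (mul_ne_zero hx0 hn)
  have hm' : 0 < y * B m := pos_iff_ne_zero.2 (mul_ne_zero hy0 hm)
  obtain ⟨n₁, hn₁⟩ := eventually_atBot.1 (hyB.eventually_lt_const hn')
  obtain ⟨m₁, hm₁⟩ := eventually_atTop.1 (hxA.eventually_lt_const hm')
  obtain ⟨N, hN, hNmax⟩ := Int.exists_greatest_of_bdd (P := fun N ↦ y * B N ≤ x * A N)
    ⟨max m m₁, fun z hz ↦ by
      by_contra! hlt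
      have h1 := hm₁ z ((le_max_right _ _).trans hlt.le)
      have h2 : y * B m ≤ y * B z := by gcongr; exact hB ((le_max_left _ _).trans hlt.le)
      exact absurd (h2.trans hz) (not_le.2 h1)⟩
    ⟨min n n₁, (hn₁ _ (min_le_right _ _)).le.trans (by gcongr; exact hA (min_le_left _ _))⟩
  refine ⟨N, ?_⟩
  have hN1 : x * A (N + 1) ≤ y * B (N + 1) := by
    by_contra! h
    have := hNmax _ h.le
    omega
  rw [mul_min, two_mul, two_mul]
  exact le_min ((hK N).trans (by gcongr)) ((hK (N + 1)).trans (by gcongr))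

/-- The summation step of the interpolation. At each scale `s` the function `G` is governed by one
index `N`, but summing over all `N` loses nothing, since the bump
`min (s^{-θδ} A_N) (s^{(1-θ)δ} B_N)` has `L^r(ds/s)` norm at most a constant times its peak
`A_N^{1-θ} B_N^θ`. -/
theorem exists_eLpNorm_bound_of_le_min {θ δ : ℝ} (hθ0 : 0 < θ) (hθ1 : θ < 1) (hδ : 0 < δ)
    {r : ℝ≥0∞} (hr : r ≠ 0) :
    ∃ C : ℝ≥0, ∀ (A B : ℤ → ℝ≥0∞) (G : ℝ → ℝ≥0∞), (∀ N, A N ≠ ⊤) → (∀ N, B N ≠ ⊤) →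
      (∀ s, 0 < s → ∃ N, G s ≤ 4 * min (ENNReal.ofReal s ^ (-(θ * δ)) * A N)
        (ENNReal.ofReal s ^ ((1 - θ) * δ) * B N)) →
      (if r = ⊤ then ⨆ (s : ℝ) (_ : 0 < s), G s
        else (∫⁻ s in Set.Ioi (0 : ℝ), G s ^ r.toReal / ENNReal.ofReal s) ^ (1 / r.toReal)) ≤
      C * eLpNorm (fun N ↦ A N ^ (1 - θ) * B N ^ θ) r Measure.count := by
  have h1θ : 0 < 1 - θ := by linarith
  rcases eq_or_ne r ⊤ with rfl | hr'
  · refine ⟨4, fun A B G hA hB hG ↦ ?_⟩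
    simp only [if_true]
    refine iSup₂_le fun s hs ↦ ?_
    obtain ⟨N, hN⟩ := hG s hs
    refine hN.trans ?_
    push_cast
    gcongr
    refine le_trans ?_ (le_eLpNorm_count (fun N ↦ A N ^ (1 - θ) * B N ^ θ) hr N)
    have hs0 : ENNReal.ofReal s ≠ 0 := by simpa using hs
    set m := min (ENNReal.ofReal s ^ (-(θ * δ)) * A N) (ENNReal.ofReal s ^ ((1 - θ) * δ) * B N)
    calc m = m ^ (1 - θ) * m ^ θ := by
          rw [← ENNReal.rpow_add_of_nonneg _ _ h1θ.le hθ0.le]; simp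
      _ ≤ (ENNReal.ofReal s ^ (-(θ * δ)) * A N) ^ (1 - θ) *
          (ENNReal.ofReal s ^ ((1 - θ) * δ) * B N) ^ θ := by
          gcongr
          · exact min_le_left _ _
          · exact min_le_right _ _
      _ = (ENNReal.ofReal s ^ (-(θ * δ) * (1 - θ)) * ENNReal.ofReal s ^ ((1 - θ) * δ * θ)) *
          (A N ^ (1 - θ) * B N ^ θ) := by
          rw [ENNReal.mul_rpow_of_nonneg _ _ h1θ.le, ENNReal.mul_rpow_of_nonneg _ _ hθ0.le,
            ← ENNReal.rpow_mul, ← ENNReal.rpow_mul]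
          ring
      _ = _ := by
          rw [← ENNReal.rpow_add _ _ hs0 (by simp),
            show -(θ * δ) * (1 - θ) + (1 - θ) * δ * θ = 0 by ring]
          simp
  have hrr := ENNReal.toReal_pos hr hr'
  obtain ⟨C, hC⟩ := exists_lintegral_min_rpow_le hθ0 hθ1 hδ hrr
  refine ⟨4 * C ^ (1 / r.toReal), fun A B G hA hB hG ↦ ?_⟩
  rw [if_neg hr', eLpNorm_count _ hr, if_neg hr', one_div, ENNReal.rpow_inv_le_iff hrr]
  set m : ℤ → ℝ → ℝ≥0∞ := fun N s ↦ min (ENNReal.ofReal s ^ (-(θ * δ)) * A N)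
        (ENNReal.ofReal s ^ ((1 - θ) * δ) * B N) with hm
  have hmeas : ∀ N, Measurable fun s ↦ (m N s) ^ r.toReal / ENNReal.ofReal s := fun N ↦ by
    simp only [hm]; fun_prop
  calc ∫⁻ s in Set.Ioi (0 : ℝ), G s ^ r.toReal / ENNReal.ofReal s
      ≤ ∫⁻ s in Set.Ioi (0 : ℝ),
          4 ^ r.toReal * ∑' N, (m N s) ^ r.toReal / ENNReal.ofReal s := by
        refine setLIntegral_mono' measurableSet_Ioi fun s hs ↦ ?_
        obtain ⟨N, hN⟩ := hG s hs
        calc G s ^ r.toReal / ENNReal.ofReal s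
            ≤ (4 * m N s) ^ r.toReal / ENNReal.ofReal s := by gcongr
          _ = 4 ^ r.toReal * ((m N s) ^ r.toReal / ENNReal.ofReal s) := by
              rw [ENNReal.mul_rpow_of_nonneg _ _ hrr.le, mul_div_assoc]
          _ ≤ _ := by
              gcongr
              exact ENNReal.le_tsum (f := fun N ↦ (m N s) ^ r.toReal / ENNReal.ofReal s) N
    _ = 4 ^ r.toReal * ∑' N, ∫⁻ s in Set.Ioi (0 : ℝ), (m N s) ^ r.toReal / ENNReal.ofReal s := by
        rw [lintegral_const_mul _ (Measurable.tsum hmeas),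
          lintegral_tsum fun N ↦ (hmeas N).aemeasurable]
    _ ≤ 4 ^ r.toReal * ∑' N, C * (A N ^ (1 - θ) * B N ^ θ) ^ r.toReal := by
        gcongr with N
        exact hC _ _ (hA N) (hB N)
    _ = _ := by
        rw [ENNReal.tsum_mul_left]
        push_cast
        rw [ENNReal.mul_rpow_of_nonneg _ _ hrr.le, ENNReal.mul_rpow_of_nonneg _ _ hrr.le,
          ENNReal.coe_rpow_of_nonneg _ (by positivity : 0 ≤ r.toReal⁻¹), ← ENNReal.rpow_mul,
          ← ENNReal.rpow_mul, inv_mul_cancel₀ hrr.ne', ENNReal.rpow_one, ENNReal.rpow_one,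
          mul_assoc]

theorem eLpNorm_tailSum_fun_le {X : Type*} [MeasurableSpace X] {μ : Measure X}
    {g : ℤ → X → ℝ≥0∞} (hg : ∀ j, AEMeasurable (g j) μ) {q : ℝ≥0∞} (hq : 1 ≤ q) (N : ℤ) :
    eLpNorm (fun x ↦ tailSum (fun j ↦ g j x) N) q μ ≤ tailSum (fun j ↦ eLpNorm (g j) q μ) N :=
  eLpNorm_tsum_le (fun _ ↦ hg _) hq

/-- At each scale `s`, some index `N` balances the part `∑_{j ≥ N} g_j`, measured in `L^{q₀}`,
against the part `∑_{j < N} g_j`, measured in `L^{q₁}`. The second tail is `∑_{j ≤ N}`, the head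
below `N + 1`. -/
theorem exists_rpow_mul_rearrangement_le {X : Type*} [MeasurableSpace X] {μ : Measure X}
    {θ α β : ℝ} (hα : 0 < α) (hβ : 0 < β) (hθ0 : 0 < θ) (hθ1 : θ < 1)
    {q₀ q₁ r₀ r₁ p : ℝ≥0∞} (hq₀ : 1 ≤ q₀) (hq : q₀ < q₁) (hr₀ : 1 ≤ r₀) (hr₁ : 1 ≤ r₁)
    (hp : p⁻¹ = ENNReal.ofReal (1 - θ) * q₀⁻¹ + ENNReal.ofReal θ * q₁⁻¹)
    {g : ℤ → X → ℝ≥0∞} {F : X → ℂ} (hg : ∀ j, AEMeasurable (g j) μ)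
    (hF : ∀ᵐ x ∂μ, ‖F x‖ₑ ≤ ∑' j, g j x)
    (h₀ : eLpNorm (fun j : ℤ ↦ (2 : ℝ≥0∞) ^ ((j : ℝ) * α) * eLpNorm (g j) q₀ μ) r₀
      Measure.count ≠ ⊤)
    (h₁ : eLpNorm (fun m : ℤ ↦ (2 : ℝ≥0∞) ^ ((m : ℝ) * β) * eLpNorm (g (-1 - m)) q₁ μ) r₁
      Measure.count ≠ ⊤) {s : ℝ} (hs : 0 < s) :
    ∃ N : ℤ, ENNReal.ofReal s ^ (1 / p.toReal) * rearrangement μ F (ENNReal.ofReal s) ≤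
      4 * min (ENNReal.ofReal s ^ (-(θ * (q₀.toReal⁻¹ - q₁.toReal⁻¹))) *
          tailSum (fun j ↦ eLpNorm (g j) q₀ μ) N)
        (ENNReal.ofReal s ^ ((1 - θ) * (q₀.toReal⁻¹ - q₁.toReal⁻¹)) *
          tailSum (fun m ↦ eLpNorm (g (-1 - m)) q₁ μ) (-1 - N)) := by
  have h1θ : 0 < 1 - θ := by linarith
  have hq₁ : 1 ≤ q₁ := hq₀.trans hq.le
  have hq₀0 : q₀ ≠ 0 := (zero_lt_one.trans_le hq₀).ne'
  have hq₁0 : q₁ ≠ 0 := (zero_lt_one.trans_le hq₁).ne'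
  have hpreal := toReal_inv_of_inv_eq hθ0.le hθ1.le hq₀0 hq₁0 hp
  set t := ENNReal.ofReal s with ht
  have ht0 : t ≠ 0 := by simpa [ht] using hs
  have htt : t ≠ ⊤ := by simp [ht]
  set A := tailSum fun j ↦ eLpNorm (g j) q₀ μ with hA
  set B := fun N : ℤ ↦ tailSum (fun m ↦ eLpNorm (g (-1 - m)) q₁ μ) (-N) with hB
  have hBmono : Monotone B := fun M N hMN ↦ tailSum_antitone _ (neg_le_neg hMN)
  have hAB : ∀ N, t ^ (1 / p.toReal) * rearrangement μ F t ≤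
      (2 * t ^ (-(θ * (q₀.toReal⁻¹ - q₁.toReal⁻¹)))) * A N +
      (2 * t ^ ((1 - θ) * (q₀.toReal⁻¹ - q₁.toReal⁻¹))) * B N := by
    intro N
    have hsplit : ∀ᵐ x ∂μ, ‖F x‖ₑ ≤ tailSum (fun j ↦ g j x) N +
        tailSum (fun m ↦ g (-1 - m) x) (-N) := by
      filter_upwards [hF] with x hx
      rwa [← tsum_eq_tailSum_add (fun j ↦ g j x) N]
    have h := rearrangement_add_self_le (s := t / 2) (q₀ := q₀) (q₁ := q₁)
      (AEMeasurable.tsum fun i : ℕ ↦ hg (N + i))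
      (AEMeasurable.tsum fun i : ℕ ↦ hg (-1 - (-N + i))) hsplit hq₀0 hq₁0
      (by simp [ht0]) (by finiteness)
    rw [ENNReal.add_halves] at h
    calc t ^ (1 / p.toReal) * rearrangement μ F t
        ≤ t ^ (1 / p.toReal) * ((2 * t ^ (-(1 / q₀.toReal))) * A N +
            (2 * t ^ (-(1 / q₁.toReal))) * B N) := by
          gcongr
          refine h.trans (add_le_add ?_ ?_)
          · exact mul_le_mul' (half_rpow_neg_le hq₀) (eLpNorm_tailSum_fun_le hg hq₀ N)
          · exact mul_le_mul' (half_rpow_neg_le hq₁)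
              (eLpNorm_tailSum_fun_le (fun m ↦ hg (-1 - m)) hq₁ (-N))
      _ = 2 * (t ^ (1 / p.toReal) * t ^ (-(1 / q₀.toReal))) * A N +
            2 * (t ^ (1 / p.toReal) * t ^ (-(1 / q₁.toReal))) * B N := by ring
      _ = _ := by
          rw [← ENNReal.rpow_add _ _ ht0 htt, ← ENNReal.rpow_add _ _ ht0 htt, one_div, one_div,
            one_div, hpreal]
          ring_nf
  obtain ⟨N, hN⟩ := exists_le_two_mul_min (tailSum_antitone _) hBmono (tendsto_tailSum hα hr₀ h₀)
    ((tendsto_tailSum hβ hr₁ h₁).comp tendsto_neg_atBot_atTop)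
    (mul_ne_zero (by norm_num) (ENNReal.rpow_pos (pos_iff_ne_zero.2 ht0) htt).ne')
    (by finiteness)
    (mul_ne_zero (by norm_num) (ENNReal.rpow_pos (pos_iff_ne_zero.2 ht0) htt).ne')
    (by finiteness) hAB
  refine ⟨N, hN.trans_eq ?_⟩
  simp only [hB]
  rw [mul_assoc, mul_assoc, ← mul_min, ← mul_assoc, show -(N + 1) = -1 - N by ring,
    show (2 : ℝ≥0∞) * 2 = 4 by norm_num]

/-- The interpolation inequality, for arbitrary functions `g_j` on a measure space: the `L^{p,r}`
norm of a function dominated by `∑_j g_j` is controlled by the norms of `2^{jα} ‖g_j‖_{q₀}` in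
`ℓ^{r₀}` and of `2^{-jβ} ‖g_j‖_{q₁}` in `ℓ^{r₁}`. -/
theorem exists_lorentzNorm_le {X : Type*} [MeasurableSpace X] (μ : Measure X)
    {θ α β : ℝ} (hα : 0 < α) (hβ : 0 < β) (hθ : θ = α / (α + β))
    {q₀ q₁ r₀ r₁ p r : ℝ≥0∞} (hq₀ : 1 ≤ q₀) (hq : q₀ < q₁) (hr₀ : 1 ≤ r₀) (hr₀₁ : r₀ ≤ r₁)
    (hp : p⁻¹ = ENNReal.ofReal (1 - θ) * q₀⁻¹ + ENNReal.ofReal θ * q₁⁻¹)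
    (hr : r⁻¹ = ENNReal.ofReal (1 - θ) * r₀⁻¹ + ENNReal.ofReal θ * r₁⁻¹) :
    ∃ C : ℝ≥0, ∀ (g : ℤ → X → ℝ≥0∞) (F : X → ℂ), (∀ j, AEMeasurable (g j) μ) →
      (∀ᵐ x ∂μ, ‖F x‖ₑ ≤ ∑' j, g j x) →
      eLpNorm (fun j : ℤ ↦ (2 : ℝ≥0∞) ^ ((j : ℝ) * α) * eLpNorm (g j) q₀ μ) r₀
        Measure.count ≠ ⊤ →
      eLpNorm (fun j : ℤ ↦ (2 : ℝ≥0∞) ^ ((j : ℝ) * (-β)) * eLpNorm (g j) q₁ μ) r₁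
        Measure.count ≠ ⊤ →
      lorentzNorm μ p r F ≤ C *
        eLpNorm (fun j : ℤ ↦ (2 : ℝ≥0∞) ^ ((j : ℝ) * α) * eLpNorm (g j) q₀ μ) r₀
          Measure.count ^ (1 - θ) *
        eLpNorm (fun j : ℤ ↦ (2 : ℝ≥0∞) ^ ((j : ℝ) * (-β)) * eLpNorm (g j) q₁ μ) r₁
          Measure.count ^ θ := by
  have hθ0 : 0 < θ := by rw [hθ]; positivity
  have hθ1 : θ < 1 := by rw [hθ, div_lt_one (by positivity)]; linarith
  have h1θ : 0 < 1 - θ := by linarith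
  have hαβ : α * (1 - θ) = β * θ := by rw [hθ]; field_simp; ring
  have hr₁ : 1 ≤ r₁ := hr₀.trans hr₀₁
  have hr₀0 : r₀ ≠ 0 := (zero_lt_one.trans_le hr₀).ne'
  have hr₁0 : r₁ ≠ 0 := (zero_lt_one.trans_le hr₁).ne'
  have hr0 : r ≠ 0 := ne_zero_of_inv_eq hr₀0 hr₁0 hr
  have hδ : 0 < q₀.toReal⁻¹ - q₁.toReal⁻¹ := by
    have h1 : q₁⁻¹ < q₀⁻¹ := ENNReal.inv_lt_inv.2 hq
    have h2 := (ENNReal.toReal_lt_toReal (h1.trans_le le_top).ne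
      (by simpa using (zero_lt_one.trans_le hq₀).ne')).2 h1
    rw [ENNReal.toReal_inv, ENNReal.toReal_inv] at h2
    linarith
  obtain ⟨C, hC⟩ := exists_eLpNorm_bound_of_le_min hθ0 hθ1 hδ hr0
  set S : ℝ → ℝ≥0∞ := fun α ↦ ∑' i : ℕ, (2 : ℝ≥0∞) ^ (-((i : ℝ) * α)) with hS
  have hSα : S α ≠ ⊤ := tsum_two_rpow_neg_ne_top hα
  have hSβ : S β ≠ ⊤ := tsum_two_rpow_neg_ne_top hβ
  refine ⟨C * (2 ^ (β * θ) * S α ^ (1 - θ) * S β ^ θ).toNNReal, fun g F hg hF h₀ h₁ ↦ ?_⟩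
  set E₀ := eLpNorm (fun j : ℤ ↦ (2 : ℝ≥0∞) ^ ((j : ℝ) * α) * eLpNorm (g j) q₀ μ) r₀
    Measure.count
  set E₁ := eLpNorm (fun j : ℤ ↦ (2 : ℝ≥0∞) ^ ((j : ℝ) * (-β)) * eLpNorm (g j) q₁ μ) r₁
    Measure.count
  have h₁' := eLpNorm_reflect_le (fun j ↦ eLpNorm (g j) q₁ μ) hβ hr₁0
  have h₁t := ne_top_of_le_ne_top h₁ h₁'
  set A := tailSum fun j ↦ eLpNorm (g j) q₀ μ with hA
  set B := tailSum fun m ↦ eLpNorm (g (-1 - m)) q₁ μ with hB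
  have key := hC A (fun N ↦ B (-1 - N))
    (fun s ↦ ENNReal.ofReal s ^ (1 / p.toReal) * rearrangement μ F (ENNReal.ofReal s))
    (tailSum_ne_top hα hr₀ h₀) (fun N ↦ tailSum_ne_top hβ hr₁ h₁t _)
    (fun s hs ↦ exists_rpow_mul_rearrangement_le hα hβ hθ0 hθ1 hq₀ hq hr₀ hr₁ hp hg hF h₀ h₁t hs)
  -- The weights cancel up to the constant `2^{βθ}`, because `α (1 - θ) = β θ`.
  have hweight : (fun N : ℤ ↦ A N ^ (1 - θ) * B (-1 - N) ^ θ) = fun N : ℤ ↦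
      2 ^ (β * θ) * ((2 ^ ((N : ℝ) * α) * A N) ^ (1 - θ) *
        (2 ^ (((-1 - N : ℤ) : ℝ) * β) * B (-1 - N)) ^ θ) := by
    funext N
    rw [ENNReal.mul_rpow_of_nonneg _ _ h1θ.le, ENNReal.mul_rpow_of_nonneg _ _ hθ0.le,
      ← ENNReal.rpow_mul, ← ENNReal.rpow_mul]
    have e : (2 : ℝ≥0∞) ^ (β * θ) * (2 ^ ((N : ℝ) * α * (1 - θ)) *
        2 ^ (((-1 - N : ℤ) : ℝ) * β * θ)) = 1 := by
      rw [← ENNReal.rpow_add _ _ (by norm_num) (by norm_num),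
        ← ENNReal.rpow_add _ _ (by norm_num) (by norm_num)]
      have : β * θ + ((N : ℝ) * α * (1 - θ) + ((-1 - N : ℤ) : ℝ) * β * θ) = 0 := by
        push_cast
        linear_combination (N : ℝ) * hαβ
      rw [this, ENNReal.rpow_zero]
    calc _ = ((2 : ℝ≥0∞) ^ (β * θ) * (2 ^ ((N : ℝ) * α * (1 - θ)) *
        2 ^ (((-1 - N : ℤ) : ℝ) * β * θ))) * (A N ^ (1 - θ) * B (-1 - N) ^ θ) := by
          rw [e, one_mul]
      _ = _ := by ring
  have hholder : eLpNorm (fun N : ℤ ↦ A N ^ (1 - θ) * B (-1 - N) ^ θ) r Measure.count ≤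
      2 ^ (β * θ) * ((S α * E₀) ^ (1 - θ) * (S β * E₁) ^ θ) := by
    rw [hweight]
    refine (eLpNorm_const_mul_ennreal _ (by finiteness) _ _).trans ?_
    gcongr
    refine (eLpNorm_rpow_mul_rpow_le (Measurable.of_discrete).aemeasurable
      (Measurable.of_discrete).aemeasurable hθ0 hθ1 hr₀0 hr₀₁ hr).trans ?_
    gcongr
    · exact eLpNorm_tailSum_le _ α hr₀
    · refine (eLpNorm_count_comp_equiv (fun N : ℤ ↦ (2 : ℝ≥0∞) ^ ((N : ℝ) * β) * B N) hr₁0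
        (Equiv.subLeft (-1))).trans_le ((eLpNorm_tailSum_le _ β hr₁).trans ?_)
      gcongr
  refine key.trans ((mul_le_mul_right hholder _).trans_eq ?_)
  rw [ENNReal.coe_mul, ENNReal.coe_toNNReal (by finiteness),
    ENNReal.mul_rpow_of_nonneg _ _ h1θ.le, ENNReal.mul_rpow_of_nonneg _ _ hθ0.le]
  ring

/-! ### Representing functions of tempered distributions -/

theorem Represents.ae_eq {n : ℕ} {g g' : EuclideanSpace ℝ (Fin n) → ℂ}
    {u : 𝓢'(EuclideanSpace ℝ (Fin n), ℂ)} (h : Represents g u) (h' : Represents g' u)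
    (hg : LocallyIntegrable g) (hg' : LocallyIntegrable g') : g =ᵐ[volume] g' := by
  refine ae_eq_of_integral_contDiff_smul_eq hg hg' fun φ hφ hφc ↦ ?_
  have hc : HasCompactSupport fun x ↦ (φ x : ℂ) := hφc.comp_left Complex.ofReal_zero
  have hs : ContDiff ℝ ∞ fun x ↦ (φ x : ℂ) := Complex.ofRealCLM.contDiff.comp hφ
  have e := (h.2 (hc.toSchwartzMap hs)).2.symm.trans (h'.2 (hc.toSchwartzMap hs)).2
  simpa using e

/-- The `L^q` norm of a distribution can be computed from any locally integrable representative;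
the same function therefore serves for both exponents `q₀` and `q₁`. -/
theorem distLpNorm_eq {n : ℕ} {g : EuclideanSpace ℝ (Fin n) → ℂ}
    {u : 𝓢'(EuclideanSpace ℝ (Fin n), ℂ)} (h : Represents g u) (hg : LocallyIntegrable g)
    {q : ℝ≥0∞} (hq : 1 ≤ q) : distLpNorm q u = eLpNorm g q volume := by
  refine le_antisymm (iInf₂_le g h) (le_iInf₂ fun g' h' ↦ ?_)
  by_cases hfin : eLpNorm g' q volume = ⊤
  · simp [hfin]
  · have hm : MemLp g' q volume := ⟨h'.1, lt_top_iff_ne_top.2 hfin⟩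
    exact (eLpNorm_congr_ae (h.ae_eq h' hg (hm.locallyIntegrable hq))).le

theorem exists_represents_of_distLpNorm_ne_top {n : ℕ} {u : 𝓢'(EuclideanSpace ℝ (Fin n), ℂ)}
    {q : ℝ≥0∞} (hq : 1 ≤ q) (h : distLpNorm q u ≠ ⊤) :
    ∃ g, Represents g u ∧ LocallyIntegrable g := by
  obtain ⟨g, hg⟩ := iInf_lt_iff.1 (lt_top_iff_ne_top.2 h)
  obtain ⟨hr, hg⟩ := iInf_lt_iff.1 hg
  exact ⟨g, hr, MemLp.locallyIntegrable ⟨hr.1, hg⟩ hq⟩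

theorem besovNorm_eq {n : ℕ} (φ : EuclideanSpace ℝ (Fin n) → ℝ) (s : ℝ) (q : ℝ≥0∞) {r : ℝ≥0∞}
    (hr : r ≠ 0) (f : 𝓢'(EuclideanSpace ℝ (Fin n), ℂ)) :
    besovNorm φ s q r f = eLpNorm
      (fun j : ℤ ↦ (2 : ℝ≥0∞) ^ ((j : ℝ) * s) * distLpNorm q (dyadicBlock φ j f)) r
        Measure.count :=
  (eLpNorm_count _ hr).symm

theorem lintegral_enorm_mul_le {X : Type*} [MeasurableSpace X] {μ : Measure X} {f g : X → ℂ}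
    (hf : AEStronglyMeasurable f μ) (hg : AEStronglyMeasurable g μ) {q q' : ℝ≥0∞}
    [ENNReal.HolderConjugate q' q] :
    ∫⁻ x, ‖f x * g x‖ₑ ∂μ ≤ eLpNorm f q' μ * eLpNorm g q μ := by
  have h := eLpNorm_smul_le_mul_eLpNorm (p := q') (q := q) (r := 1) hg hf
  rwa [eLpNorm_one_eq_lintegral_enorm] at h

/-- Pairing with a Schwartz function is bounded on every `L^q`, `1 ≤ q ≤ ∞`. -/
theorem exists_lintegral_enorm_mul_le {n : ℕ} (h : 𝓢(EuclideanSpace ℝ (Fin n), ℂ)) {q : ℝ≥0∞}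
    (hq : 1 ≤ q) : ∃ C : ℝ≥0∞, C ≠ ⊤ ∧ ∀ g : EuclideanSpace ℝ (Fin n) → ℂ,
      AEStronglyMeasurable g volume → ∫⁻ x, ‖h x * g x‖ₑ ≤ C * eLpNorm g q volume := by
  obtain ⟨q', hq'⟩ : ∃ q', ENNReal.HolderConjugate q' q := by
    refine ⟨(1 - q⁻¹)⁻¹, ?_⟩
    rw [ENNReal.holderConjugate_iff, inv_inv]
    exact tsub_add_cancel_of_le (ENNReal.inv_le_one.2 hq)
  have hh := h.memLp q' (volume : Measure (EuclideanSpace ℝ (Fin n)))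
  exact ⟨eLpNorm h q' volume, hh.eLpNorm_ne_top, fun g hg ↦ lintegral_enorm_mul_le hh.1 hg⟩

/-- A distribution that is the sum of distributions `u_j` represented by functions `g_j` is
represented by `∑_j g_j`, if `∑_{j ≥ 0} ‖g_j‖_{q₀}` and `∑_{j < 0} ‖g_j‖_{q₁}` are finite: the
series `∑_j h g_j` then converges absolutely in `L¹` for every Schwartz function `h`. -/
theorem Represents.tsum {n : ℕ} {g : ℤ → EuclideanSpace ℝ (Fin n) → ℂ}
    {u : ℤ → 𝓢'(EuclideanSpace ℝ (Fin n), ℂ)} {f : 𝓢'(EuclideanSpace ℝ (Fin n), ℂ)}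
    (hg : ∀ j, Represents (g j) (u j))
    (hf : Tendsto (fun N : ℕ × ℕ ↦ ∑ j ∈ Finset.Ico (-(N.1 : ℤ)) (N.2 : ℤ), u j) atTop (𝓝 f))
    {q₀ q₁ : ℝ≥0∞} (hq₀ : 1 ≤ q₀) (hq₁ : 1 ≤ q₁)
    (h₀ : tailSum (fun j ↦ eLpNorm (g j) q₀ volume) 0 ≠ ⊤)
    (h₁ : tailSum (fun m ↦ eLpNorm (g (-1 - m)) q₁ volume) 0 ≠ ⊤) :
    Represents (fun x ↦ ∑' j, g j x) f := by
  have hmeas : AEMeasurable (fun x ↦ ∑' j, g j x) volume :=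
    AEMeasurable.tsum fun j ↦ (hg j).1.aemeasurable
  refine ⟨hmeas.aestronglyMeasurable, fun h ↦ ?_⟩
  obtain ⟨C₀, hC₀, hle₀⟩ := exists_lintegral_enorm_mul_le h hq₀
  obtain ⟨C₁, hC₁, hle₁⟩ := exists_lintegral_enorm_mul_le h hq₁
  have hfin : ∑' j, ∫⁻ x, ‖h x * g j x‖ₑ ≠ ⊤ := by
    rw [tsum_eq_tailSum_add _ 0, neg_zero]
    refine ne_top_of_le_ne_top (ENNReal.add_ne_top.2 ⟨ENNReal.mul_ne_top hC₀ h₀,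
      ENNReal.mul_ne_top hC₁ h₁⟩) (add_le_add ?_ ?_)
    · rw [tailSum, tailSum, ← ENNReal.tsum_mul_left]
      exact ENNReal.tsum_le_tsum fun i ↦ hle₀ _ (hg _).1
    · rw [tailSum, tailSum, ← ENNReal.tsum_mul_left]
      exact ENNReal.tsum_le_tsum fun i ↦ hle₁ _ (hg _).1
  have hint : ∀ j, Integrable (fun x ↦ h x * g j x) := fun j ↦ ((hg j).2 h).1
  have hsum : Summable fun j ↦ ∫ x, ‖h x * g j x‖ := by
    have := ENNReal.summable_toReal hfin
    refine this.congr fun j ↦ ?_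
    rw [integral_norm_eq_lintegral_enorm (hint j).1]
  have hs := hasSum_integral_of_summable_integral_norm hint hsum
  simp only [tsum_mul_left] at hs
  constructor
  · refine ⟨h.continuous.aestronglyMeasurable.mul hmeas.aestronglyMeasurable, ?_⟩
    refine lt_of_le_of_lt ?_ (lt_top_iff_ne_top.2 hfin)
    rw [← lintegral_tsum fun j ↦ (hint j).1.enorm]
    refine lintegral_mono fun x ↦ ?_
    simp only [← tsum_mul_left]
    exact enorm_tsum_le_tsum_enorm
  · have hIco : Tendsto (fun N : ℕ × ℕ ↦ Finset.Ico (-(N.1 : ℤ)) (N.2 : ℤ)) atTop atTop := by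
      refine tendsto_atTop_finset_of_monotone (fun M N hMN ↦ ?_) fun j ↦
        ⟨(j.natAbs, j.natAbs + 1), ?_⟩
      · exact Finset.Ico_subset_Ico (by have := hMN.1; simpa using this)
          (by have := hMN.2; simpa using this)
      · rw [Finset.mem_Ico]
        rw [Nat.cast_add, Nat.cast_one]
        omega
    have h1 := PointwiseConvergenceCLM.tendsto_iff_forall_tendsto.1 hf h
    refine tendsto_nhds_unique h1 ((hs.comp hIco).congr fun N ↦ ?_)
    simp only [Function.comp_apply]
    rw [sum_apply]
    exact Finset.sum_congr rfl fun j _ ↦ ((hg j).2 h).2.symm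

end LorentzBesov

theorem theorem4 {n : ℕ} (φ : EuclideanSpace ℝ (Fin n) → ℝ) (hφ : LorentzBesov.IsCutoff φ)
    (α β θ : ℝ) (hα : 0 < α) (hβ : 0 < β) (hθ : θ = α / (α + β))
    (q₀ q₁ r₀ r₁ p r : ℝ≥0∞) (hq₀ : 1 ≤ q₀) (hq : q₀ < q₁)
    (hqr₀ : q₀ ≤ r₀) (hr : r₀ ≤ r₁) (hqr₁ : r₁ ≤ q₁)
    (hp_eq : p⁻¹ = ENNReal.ofReal (1 - θ) * q₀⁻¹ + ENNReal.ofReal θ * q₁⁻¹)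
    (hr_eq : r⁻¹ = ENNReal.ofReal (1 - θ) * r₀⁻¹ + ENNReal.ofReal θ * r₁⁻¹) :
    ∃ C : ℝ≥0, ∀ f : 𝓢'(EuclideanSpace ℝ (Fin n), ℂ),
      LorentzBesov.HasDyadicDecomposition φ f →
      LorentzBesov.besovNorm φ α q₀ r₀ f < ⊤ →
      LorentzBesov.besovNorm φ (-β) q₁ r₁ f < ⊤ →
      ∃ F : EuclideanSpace ℝ (Fin n) → ℂ, LorentzBesov.Represents F f ∧
        LorentzBesov.lorentzNorm volume p r F ≤
          (C : ℝ≥0∞) * LorentzBesov.besovNorm φ α q₀ r₀ f ^ (1 - θ) *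
            LorentzBesov.besovNorm φ (-β) q₁ r₁ f ^ θ := by
  open LorentzBesov in
  have hq₁ : 1 ≤ q₁ := hq₀.trans hq.le
  have hr₀ : 1 ≤ r₀ := hq₀.trans hqr₀
  have hr₁ : 1 ≤ r₁ := hr₀.trans hr
  have hr₀0 : r₀ ≠ 0 := (zero_lt_one.trans_le hr₀).ne'
  have hr₁0 : r₁ ≠ 0 := (zero_lt_one.trans_le hr₁).ne'
  obtain ⟨C, hC⟩ := exists_lorentzNorm_le (volume : Measure (EuclideanSpace ℝ (Fin n)))
    hα hβ hθ hq₀ hq hr₀ hr hp_eq hr_eq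
  refine ⟨C, fun f hf h₀ h₁ ↦ ?_⟩
  rw [besovNorm_eq φ α q₀ hr₀0] at h₀ ⊢
  rw [besovNorm_eq φ (-β) q₁ hr₁0] at h₁ ⊢
  have hblock : ∀ j, distLpNorm q₀ (dyadicBlock φ j f) ≠ ⊤ := fun j hj ↦ by
    have := (le_eLpNorm_count _ hr₀0 j).trans_lt h₀
    simp [hj, ENNReal.mul_top] at this
  choose g hg hloc using fun j ↦ exists_represents_of_distLpNorm_ne_top hq₀ (hblock j)
  simp only [fun j ↦ distLpNorm_eq (hg j) (hloc j) hq₀] at h₀ ⊢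
  simp only [fun j ↦ distLpNorm_eq (hg j) (hloc j) hq₁] at h₁ ⊢
  have h₁' := ne_top_of_le_ne_top h₁.ne
    (eLpNorm_reflect_le (fun j ↦ eLpNorm (g j) q₁ volume) hβ hr₁0)
  refine ⟨fun x ↦ ∑' j, g j x, Represents.tsum hg hf hq₀ hq₁ (tailSum_ne_top hα hr₀ h₀.ne 0)
    (tailSum_ne_top hβ hr₁ h₁' 0), ?_⟩
  have := hC (fun j x ↦ ‖g j x‖ₑ) (fun x ↦ ∑' j, g j x) (fun j ↦ (hg j).1.enorm)
    (ae_of_all _ fun x ↦ enorm_tsum_le_tsum_enorm)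
  simp only [eLpNorm_enorm] at this
  exact this h₀.ne h₁.ne
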